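/- A \emph{complete multipartite directed graph} is a structure $(V,E)$ with $E$ an asymmetric (hence irreflexive) binary relation such that the non-edge relation $x\perp y :\Leftrightarrow \neg E(x,y)\wedge\neg E(y,x)$ is an equivalence relation; its classes are called the \emph{parts}. Let $\omega*I_\omega$ be the Fraïssé limit of the class of all finite complete multipartite directed graphs (with no bound on the number of parts), i.e. the countable homogeneous directed graph whose finite induced subgraphs are, up to isomorphism, exactly these. Let $\omega*I_\omega^*=(\omega*I_\omega,<)$ be an expansion of $\omega*I_\omega$ by a linear ordering $<$ which is convex (if $x<y<z$ and $x\perp z$, then $x\perp y$), orders each part densely, and induces a dense ordering on the set of parts. Let $\mathrm{Age}(\omega*I_\omega^*)$ be the class of all finite structures in the language $\{E,<\}$ that embed in $\omega*I_\omega^*$. For structures $\mathbf A,\mathbf B$ let $\binom{\mathbf B}{\mathbf A}$ denote the set of substructures of $\mathbf B$ isomorphic to $\mathbf A$. \textbf{Theorem.} $\mathrm{Age}(\omega*I_\omega^*)$ has the Ramsey property: for all $k\in\mathbb N$ and all $\mathbf A,\mathbf B\in\mathrm{Age}(\omega*I_\omega^*)$ there is $\mathbf C\in\mathrm{Age}(\omega*I_\omega^*)$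 such that for every map $c:\binom{\mathbf C}{\mathbf A}\to\{0,\dots,k-1\}$ there is $\widetilde{\mathbf B}\in\binom{\mathbf C}{\mathbf B}$ such that $c$ takes at most one value on $\binom{\widetilde{\mathbf B}}{\mathbf A}$. -/

import Mathlib

namespace PartiteDigraph

open FirstOrder FirstOrder.Language CategoryTheory

universe u v w

section Ramsey

variable {L : FirstOrder.Language.{u, v}}

/-- The set of all copies of `A` in `B`: substructures of `B` isomorphic to `A`. -/
def Copies (B A : Type w) [L.Structure B] [L.Structure A] : Set (L.Substructure B) :=
  {S | Nonempty (S ≃[L] A)}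

/-- The partition relation `C ⟶ (B)^A_{k,l}`: for every colouring `c` of the copies of `A` in `C`
with `k` colours there is a copy `D` of `B` in `C` such that `c` takes at most `l` values on the
copies of `A` which are contained in `D`. -/
def Arrows (C B A : Type w) [L.Structure C] [L.Structure B] [L.Structure A] (k l : ℕ) : Prop :=
  ∀ c : Copies (L := L) C A → Fin k, ∃ D ∈ Copies (L := L) C B,
    (c '' {S | S.1 ≤ D}).ncard ≤ l

/-- The Ramsey property of a class of structures. -/
def RamseyProperty (K : Set (Bundled.{w} L.Structure)) : Prop :=
  ∀ k : ℕ, ∀ A ∈ K, ∀ B ∈ K, ∃ C ∈ K, Arrows (L := L) C B A k 1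

end Ramsey

/-- The relation symbols of the language of directed graphs: a binary symbol. -/
inductive DigraphRel : ℕ → Type
  | edge : DigraphRel 2

/-- The language of directed graphs. -/
def digraphLang : FirstOrder.Language.{0, 0} := ⟨fun _ => Empty, DigraphRel⟩

instance : digraphLang.IsRelational := fun _ => inferInstanceAs (IsEmpty Empty)

/-- The relation symbols of the language of directed graphs with an additional binary symbol
for a linear ordering. -/
inductive OrderedDigraphRel : ℕ → Type
  | edge : OrderedDigraphRel 2
  | lt : OrderedDigraphRel 2

/-- The language of ordered directed graphs. -/
def orderedDigraphLang : FirstOrder.Language.{0, 0} := ⟨fun _ => Empty, OrderedDigraphRel⟩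

instance : orderedDigraphLang.IsRelational := fun _ => inferInstanceAs (IsEmpty Empty)

/-- The structure with universe `V` and edge relation `E`. -/
@[reducible] def digraphStructure {V : Type u} (E : V → V → Prop) : digraphLang.Structure V where
  funMap f := f.elim
  RelMap | .edge => fun x => E (x 0) (x 1)

/-- The expansion of the structure with universe `V` and edge relation `E` by the relation `lt`. -/
@[reducible] def orderedDigraphStructure {V : Type u} (E lt : V → V → Prop) :
    orderedDigraphLang.Structure V where
  funMap f := f.elim
  RelMap
    | .edge => fun x => E (x 0) (x 1)
    | .lt => fun x => lt (x 0) (x 1)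

/-- The edge relation of a structure in the language of directed graphs. -/
def Edge {V : Type u} [digraphLang.Structure V] (x y : V) : Prop :=
  Structure.RelMap (L := digraphLang) (M := V) DigraphRel.edge ![x, y]

/-- The non-edge relation `⊥`. -/
def NonEdge {V : Type u} (E : V → V → Prop) (x y : V) : Prop := ¬ E x y ∧ ¬ E y x

/-- `(V, E)` is a complete multipartite directed graph: `E` is asymmetric (hence irreflexive) and
`⊥` is an equivalence relation. Its classes are the parts. -/
structure IsCompleteMultipartite {V : Type u} (E : V → V → Prop) : Prop where
  asymm : ∀ x y, E x y → ¬ E y x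
  equivalence : Equivalence (NonEdge E)

/-- The class of all finite complete multipartite directed graphs, with no bound on the number of
parts. -/
def finiteCompleteMultipartite : Set (Bundled.{u} digraphLang.Structure) :=
  {A | Finite A ∧ IsCompleteMultipartite (Edge : A → A → Prop)}

/-- `(V, E)` is the generic complete multipartite directed graph with infinitely many parts:
the Fraïssé limit of the class of all finite complete multipartite directed graphs. -/
def IsGenericMultipartite {V : Type u} [Countable V] (E : V → V → Prop) : Prop :=
  letI := digraphStructure E
  IsFraisseLimit (L := digraphLang) finiteCompleteMultipartite.{u} V

/-- `lt` is a (strict) linear ordering of the vertices of the multipartite directed graph `(V, E)`,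
convex (each part is an interval), which orders each part densely and induces a dense ordering
on the set of parts. -/
structure IsDenseConvexOrder {V : Type u} (E lt : V → V → Prop) : Prop where
  linear : IsStrictTotalOrder V lt
  convex : ∀ x y z, lt x y → lt y z → NonEdge E x z → NonEdge E x y
  dense_part : ∀ x y, NonEdge E x y → lt x y → ∃ z, NonEdge E x z ∧ lt x z ∧ lt z y
  dense_parts : ∀ x y, ¬ NonEdge E x y → lt x y →
    ∃ z, ¬ NonEdge E x z ∧ ¬ NonEdge E z y ∧ lt x z ∧ lt z y

/-- The age of the ordered directed graph `(V, E, lt)`. -/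
def orderedAge {V : Type u} (E lt : V → V → Prop) : Set (Bundled.{u} orderedDigraphLang.Structure) :=
  letI := orderedDigraphStructure E lt
  orderedDigraphLang.age V

end PartiteDigraph

namespace PartiteDigraph

universe u v w u₁ u₂

/-! The proof has two halves: a Ramsey theorem for finite convexly ordered complete multipartite
digraphs, and the identification of the age with that class.

The Ramsey half is a partite construction in the style of Nešetřil and Rödl. The order data of such
a digraph is recorded by a linear order, its skeleton (parts followed by vertices), and an embedding
of the skeleton in `Fin N` sends each vertex to a point of the square `Fin N × Fin N`, the first
coordinate encoding the part. Over this square one builds digraphs whose parts are the fibres of the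
first coordinate, starting from a disjoint union of copies of `B`. The Hales–Jewett theorem
(`exists_monochromatic_sections`) makes all copies of `A` over one fixed image monochromatic.
Iterating over the finitely many images makes the colour depend on the image alone. The finite
Ramsey theorem for skeletons then selects a copy of `B` on which the colour is constant. A
lexicographic order on the result restores the convex order.

For the age, every finite substructure is clearly convexly ordered, but the ordering is not assumed
generic, so the converse needs the ordering property (`exists_ordering_property`): a given ordered
digraph appears under every linear ordering of some finite complete multipartite digraph. It follows
from the Ramsey half, applied to colourings of pairs. -/

/-! ### The finite Ramsey theorem. -/

/-- If colourings of `a`-subsets admit large homogeneous sets, then colourings of `(a + 1)`-subsets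
admit large sets on which the colour only depends on the minimum. -/
theorem exists_minHomogeneous {κ : Type v} [Nonempty κ] (a : ℕ)
    (ih : ∀ b : ℕ, ∃ N : ℕ, ∀ (α : Type u) [LinearOrder α] (S : Finset α), N ≤ S.card →
      ∀ c : Finset α → κ, ∃ T ⊆ S, T.card = b ∧ ∃ col, ∀ U ⊆ T, U.card = a → c U = col) (m : ℕ) :
    ∃ N : ℕ, ∀ (α : Type u) [LinearOrder α] (S : Finset α), N ≤ S.card →
      ∀ c : Finset α → κ, ∃ T ⊆ S, T.card = m ∧
        ∃ f : α → κ, ∀ x ∈ T, ∀ U ⊆ T, (∀ u ∈ U, x < u) → U.card = a →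
        c (insert x U) = f x := by
  induction m with
  | zero =>
    exact ⟨0, fun α _ S _ c => ⟨∅, by simp, rfl, fun _ => Classical.arbitrary κ, by simp⟩⟩
  | succ m IH =>
    obtain ⟨N₁, h₁⟩ := IH
    obtain ⟨N₂, h₂⟩ := ih N₁
    refine ⟨N₂ + 1, fun α _ S hS c => ?_⟩
    have hne : S.Nonempty := Finset.card_pos.1 (by omega)
    set x₀ := S.min' hne
    have hx₀ : x₀ ∈ S := S.min'_mem hne
    -- Fix the minimum `x₀` and make the induced colouring of `a`-subsets above it constant, keeping
    -- `N₁` points for the recursion.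
    obtain ⟨S', hS', hcard, col, hcol⟩ := h₂ α (S.erase x₀)
      (by rw [Finset.card_erase_of_mem hx₀]; omega) (fun U => c (insert x₀ U))
    obtain ⟨T, hT, hTcard, f, hf⟩ := h₁ α S' hcard.ge c
    have hlt : ∀ x ∈ T, x₀ < x := fun x hx =>
      Finset.min'_lt_of_mem_erase_min' _ hne (hS' (hT hx))
    have hxT : x₀ ∉ T := fun h => lt_irrefl _ (hlt _ h)
    refine ⟨insert x₀ T, ?_, by rw [Finset.card_insert_of_notMem hxT, hTcard],
      Function.update f x₀ col, ?_⟩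
    · exact Finset.insert_subset hx₀ ((hT.trans hS').trans (Finset.erase_subset _ _))
    · intro x hx U hU hxU hUa
      have hUT : x₀ ≤ x → U ⊆ T := fun hle u hu =>
        (Finset.mem_insert.1 (hU hu)).resolve_left (hle.trans_lt (hxU u hu)).ne'
      rcases Finset.mem_insert.1 hx with rfl | hx
      · rw [Function.update_self]
        exact hcol U ((hUT le_rfl).trans hT) hUa
      · rw [Function.update_of_ne (hlt x hx).ne']
        exact hf x hx U (hUT (hlt x hx).le) hxU hUa

/-- The finite Ramsey theorem, for finite subsets of a linear order. -/
theorem finite_ramsey (κ : Type v) [Finite κ] [Nonempty κ]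
    (a b : ℕ) :
    ∃ N : ℕ, ∀ (α : Type u) [LinearOrder α] (S : Finset α), N ≤ S.card →
      ∀ c : Finset α → κ, ∃ T ⊆ S, T.card = b ∧ ∃ col, ∀ U ⊆ T, U.card = a → c U = col := by
  induction a generalizing b with
  | zero =>
    refine ⟨b, fun α _ S hS c => ?_⟩
    obtain ⟨T, hT, hTb⟩ := Finset.exists_subset_card_eq hS
    exact ⟨T, hT, hTb, c ∅, fun U _ hU => by rw [Finset.card_eq_zero.1 hU]⟩
  | succ a ih =>
    classical
    have := Fintype.ofFinite κ
    -- The size lets the pigeonhole principle find `b` points whose colours as minima coincide.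
    obtain ⟨N, hN⟩ := exists_minHomogeneous a ih (Fintype.card κ * b)
    refine ⟨N, fun α _ S hS c => ?_⟩
    obtain ⟨T, hT, hTcard, f, hf⟩ := hN α S hS c
    obtain ⟨col, -, hcol⟩ := Finset.exists_le_card_fiber_of_mul_le_card_of_maps_to
      (s := T) (t := Finset.univ) (f := f) (n := b) (by simp) Finset.univ_nonempty
      (by rw [hTcard, Finset.card_univ])
    obtain ⟨T', hT', hT'b⟩ := Finset.exists_subset_card_eq hcol
    refine ⟨T', (hT'.trans (Finset.filter_subset _ _)).trans hT, hT'b, col, fun U hU hUa => ?_⟩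
    have hne : U.Nonempty := Finset.card_pos.1 (by omega)
    have hmem := U.min'_mem hne
    have h := hf (U.min' hne) (Finset.mem_filter.1 (hT' (hU hmem))).1 (U.erase (U.min' hne))
      (((Finset.erase_subset _ _).trans hU).trans (hT'.trans (Finset.filter_subset _ _)))
      (fun u hu => Finset.min'_lt_of_mem_erase_min' _ hne hu)
      (by rw [Finset.card_erase_of_mem hmem, hUa]; rfl)
    rw [Finset.insert_erase hmem] at h
    rw [h]
    exact (Finset.mem_filter.1 (hT' (hU hmem))).2

/-- The Ramsey property of finite linear orders, in terms of order embeddings. -/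
theorem ramsey_orderEmbedding (A : Type u₁) (B : Type u₂) [LinearOrder A] [LinearOrder B]
    [Finite A] [Finite B] (κ : Type v) [Finite κ] [Nonempty κ] :
    ∃ N : ℕ, ∀ c : (A ↪o Fin N) → κ, ∃ w : B ↪o Fin N, ∃ col, ∀ u : A ↪o B,
      c (u.trans w) = col := by
  classical
  have := Fintype.ofFinite A
  have := Fintype.ofFinite B
  obtain ⟨N, hN⟩ := finite_ramsey κ (Fintype.card A) (Fintype.card B)
  refine ⟨N, fun c => ?_⟩
  let eA := Fintype.orderIsoFinOfCardEq A rfl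
  let eB := Fintype.orderIsoFinOfCardEq B rfl
  obtain ⟨T, -, hTcard, col, hcol⟩ := hN (Fin N) Finset.univ (by simp) (fun U =>
    if h : U.card = Fintype.card A then c (eA.symm.toOrderEmbedding.trans (U.orderEmbOfFin h))
    else Classical.arbitrary κ)
  refine ⟨eB.symm.toOrderEmbedding.trans (T.orderEmbOfFin hTcard), col, fun u => ?_⟩
  set v := u.trans (eB.symm.toOrderEmbedding.trans (T.orderEmbOfFin hTcard))
  have hcard : (Finset.univ.map v.toEmbedding).card = Fintype.card A := by simp
  rw [← hcol (Finset.univ.map v.toEmbedding) (fun x hx => ?_) hcard, dif_pos hcard,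
    ← Finset.orderEmbOfFin_unique' hcard (f := eA.toOrderEmbedding.trans v) (fun x => by simp)]
  · congr 1
    ext x
    simp
  · obtain ⟨y, -, rfl⟩ := Finset.mem_map.1 hx
    exact Finset.orderEmbOfFin_mem _ hTcard _

/-! ### Partite systems and the partite lemma. -/

/-- A partite system over `X`: the digraph `(P, E)` projects to `X` by `π`, and its parts are the
fibres of `part ∘ π`. -/
structure IsPartiteSystem {X : Type u₁} {Y : Type u₂} (part : X → Y) {P : Type w} (π : P → X)
    (E : P → P → Prop) : Prop where
  asymm : ∀ p q, E p q → ¬ E q p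
  nonEdge_iff : ∀ p q, NonEdge E p q ↔ part (π p) = part (π q)

/-- `s` is a section over `e` which preserves edges. -/
structure IsHomOver {A : Type v} {P : Type w} {X : Type u₁} (e : A → X) (π : P → X)
    (EA : A → A → Prop) (E : P → P → Prop) (s : A → P) : Prop where
  proj : ∀ a, π (s a) = e a
  map_edge : ∀ a b, EA a b → E (s a) (s b)

theorem IsHomOver.comp {A : Type v} {P : Type w} {Q : Type u} {X : Type u₁} {e : A → X}
    {π : P → X} {ρ : Q → X} {EA : A → A → Prop} {EP : P → P → Prop} {EQ : Q → Q → Prop}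
    {s : A → P} {g : P → Q} (hg : IsHomOver π ρ EP EQ g) (hs : IsHomOver e π EA EP s) :
    IsHomOver e ρ EA EQ (g ∘ s) where
  proj a := (hg.proj _).trans (hs.proj a)
  map_edge a b h := hg.map_edge _ _ (hs.map_edge a b h)

theorem IsPartiteSystem.not_edge {X : Type u₁} {Y : Type u₂} {part : X → Y} {P : Type w}
    {π : P → X} {E : P → P → Prop} (h : IsPartiteSystem part π E) {p q : P}
    (hpq : part (π p) = part (π q)) : ¬ E p q :=
  ((h.nonEdge_iff p q).2 hpq).1

theorem IsPartiteSystem.edge_or_edge {X : Type u₁} {Y : Type u₂} {part : X → Y} {P : Type w}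
    {π : P → X} {E : P → P → Prop} (h : IsPartiteSystem part π E) {p q : P}
    (hpq : part (π p) ≠ part (π q)) : E p q ∨ E q p := by
  by_contra hn
  exact hpq ((h.nonEdge_iff p q).1 (not_or.1 hn))

/-- The vertices of the `ι`-th power of the partite system `P` over `X`: families contained in a
fibre of the projection, together with a distinguished coordinate. -/
def PartitePower {P : Type w} {X : Type u₁} (π : P → X) (ι : Type v) : Type max w v :=
  {x : (ι → P) × ι // ∀ j, π (x.1 j) = π (x.1 x.2)}

namespace PartitePower

variable {P : Type w} {X : Type u₁} {π : P → X} {ι : Type v}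

/-- The projection of the power of a partite system. -/
def proj (x : PartitePower π ι) : X := π (x.1.1 x.1.2)

open Classical in
/-- The edges of the power of a partite system, where `G` is the edge relation of a copy with vertex
set `S`. Above `S` an edge agrees with `G` if it does so in all coordinates; elsewhere it is read off
at a distinguished coordinate. -/
def Edge (S : Set X) (G : X → X → Prop) (E : P → P → Prop) (x y : PartitePower π ι) : Prop :=
  if x.proj ∈ S ∧ y.proj ∈ S then
    if G x.proj y.proj then ∀ j, E (x.1.1 j) (y.1.1 j) else ∃ j, E (x.1.1 j) (y.1.1 j)
  else E (x.1.1 (if x.proj ∈ S then y.1.2 else x.1.2)) (y.1.1 (if y.proj ∈ S then x.1.2 else y.1.2))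

/-- Between different parts each coordinate carries exactly one of the two edges, so above `S` the
"all coordinates" and "some coordinate" clauses are complementary. When at least one point lies off
`S`, both directions read the same coordinates and the claim is inherited from `P`. -/
theorem isPartiteSystem {Y : Type u₂} {part : X → Y} {E : P → P → Prop}
    (hP : IsPartiteSystem part π E) {S : Set X} {G : X → X → Prop} (hG : ∀ x y, G x y → ¬ G y x)
    (hSG : ∀ x ∈ S, ∀ y ∈ S, ¬ G x y → ¬ G y x → part x = part y) :
    IsPartiteSystem part (proj : PartitePower π ι → X) (Edge S G E) := by
  classical
  have hfib : ∀ (x : PartitePower π ι) j, π (x.1.1 j) = x.proj := fun x => x.2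
  have hasymm : ∀ x y : PartitePower π ι, Edge S G E x y → ¬ Edge S G E y x := by
    intro x y hxy hyx
    unfold Edge at hxy hyx
    by_cases hS : x.proj ∈ S ∧ y.proj ∈ S
    · rw [if_pos hS] at hxy
      rw [if_pos hS.symm] at hyx
      by_cases h₁ : G x.proj y.proj
      · rw [if_pos h₁] at hxy
        rw [if_neg (hG _ _ h₁)] at hyx
        obtain ⟨j, hj⟩ := hyx
        exact hP.asymm _ _ hj (hxy j)
      · rw [if_neg h₁] at hxy
        obtain ⟨j, hj⟩ := hxy
        by_cases h₂ : G y.proj x.proj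
        · rw [if_pos h₂] at hyx
          exact hP.asymm _ _ hj (hyx j)
        · refine hP.not_edge ?_ hj
          rw [hfib, hfib, hSG _ hS.1 _ hS.2 h₁ h₂]
    · rw [if_neg hS] at hxy
      rw [if_neg (fun h => hS h.symm)] at hyx
      exact hP.asymm _ _ hxy hyx
  refine ⟨hasymm, fun x y => ⟨fun h => ?_, fun h => ?_⟩⟩
  · by_contra hne
    have hor : ∀ i j, E (x.1.1 i) (y.1.1 j) ∨ E (y.1.1 j) (x.1.1 i) := fun i j =>
      hP.edge_or_edge (by rwa [hfib, hfib])
    obtain ⟨h₁, h₂⟩ := h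
    unfold Edge at h₁ h₂
    by_cases hS : x.proj ∈ S ∧ y.proj ∈ S
    · rw [if_pos hS] at h₁
      rw [if_pos hS.symm] at h₂
      by_cases hxy : G x.proj y.proj
      · rw [if_pos hxy] at h₁
        rw [if_neg (hG _ _ hxy)] at h₂
        exact h₁ fun j => (hor j j).resolve_right fun hj => h₂ ⟨j, hj⟩
      · by_cases hyx : G y.proj x.proj
        · rw [if_neg hxy] at h₁
          rw [if_pos hyx] at h₂
          exact h₂ fun j => (hor j j).resolve_left fun hj => h₁ ⟨j, hj⟩
        · exact hne (hSG _ hS.1 _ hS.2 hxy hyx)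
    · rw [if_neg hS] at h₁
      rw [if_neg (fun h => hS h.symm)] at h₂
      exact (hor _ _).elim h₁ h₂
  · have hno : ∀ i j, ¬ E (x.1.1 i) (y.1.1 j) ∧ ¬ E (y.1.1 j) (x.1.1 i) := fun i j =>
      (hP.nonEdge_iff _ _).2 (by rw [hfib, hfib, h])
    unfold NonEdge Edge
    by_cases hS : x.proj ∈ S ∧ y.proj ∈ S
    · rw [if_pos hS, if_pos hS.symm]
      refine ⟨fun h => ?_, fun h => ?_⟩
      · split_ifs at h
        · exact (hno x.1.2 x.1.2).1 (h _)
        · exact (hno _ _).1 h.choose_spec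
      · split_ifs at h
        · exact (hno x.1.2 x.1.2).2 (h _)
        · exact (hno _ _).2 h.choose_spec
    · rw [if_neg hS, if_neg (fun h' : y.proj ∈ S ∧ x.proj ∈ S => hS h'.symm)]
      exact hno _ _

end PartitePower

/-- The partite lemma: the sections over a single `e` can be made monochromatic. -/
theorem exists_monochromatic_sections {X : Type u₁} {Y : Type u₂} (part : X → Y) {A : Type u}
    [Finite A] {EA : A → A → Prop} (hEA : ∀ a b, EA a b → ¬ EA b a) {e : A → X}
    (he : Function.Injective e) (hpart : ∀ a b, NonEdge EA a b → part (e a) = part (e b))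
    (κ : Type v) [Finite κ] [Nonempty κ] {P : Type w} [Finite P] {π : P → X} {E : P → P → Prop}
    (hP : IsPartiteSystem part π E) :
    ∃ (Q : Type w) (_ : Finite Q) (ρ : Q → X) (F : Q → Q → Prop), IsPartiteSystem part ρ F ∧
      ∀ c : (A → Q) → κ, ∃ g, IsHomOver π ρ E F g ∧
        ∃ col, ∀ s, IsHomOver e π EA E s → c (g ∘ s) = col := by
  classical
  -- Hales–Jewett is applied with the sections over `e` as letters. Each word gives a family of
  -- points over the image of `e`.
  let T := {s : A → P // IsHomOver e π EA E s}
  obtain ⟨ι, _, hι⟩ := Combinatorics.Line.exists_mono_in_high_dimension T κ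
  have hne : Nonempty ι := by
    obtain ⟨l, -⟩ := hι fun _ => Classical.arbitrary κ
    exact ⟨l.proper.choose⟩
  let i₀ : ι := Classical.arbitrary ι
  let S : Set X := Set.range e
  let G : X → X → Prop := fun x y => ∃ a b, e a = x ∧ e b = y ∧ EA a b
  have hGe : ∀ a b, G (e a) (e b) ↔ EA a b := by
    refine fun a b => ⟨?_, fun h => ⟨a, b, rfl, rfl, h⟩⟩
    rintro ⟨a', b', ha, hb, h⟩
    rwa [← he ha, ← he hb]
  refine ⟨PartitePower π ι, Subtype.finite, PartitePower.proj, PartitePower.Edge S G E,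
    PartitePower.isPartiteSystem hP ?_ ?_, fun c => ?_⟩
  · rintro _ _ ⟨a, b, rfl, rfl, h⟩ h'
    exact hEA a b h ((hGe b a).1 h')
  · rintro _ ⟨a, rfl⟩ _ ⟨b, rfl⟩ h₁ h₂
    exact hpart a b ⟨fun h => h₁ ((hGe a b).2 h), fun h => h₂ ((hGe b a).2 h)⟩
  obtain ⟨l, col, hl⟩ := hι fun τ => c fun a =>
    ⟨(fun j => (τ j).1 a, i₀), fun j => by simp only [(τ _).2.proj]⟩
  obtain ⟨iL, hiL⟩ := l.proper
  -- The line extends to all of `P`: an active coordinate keeps `q`, while a constant coordinate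
  -- with letter `t` replaces `q` by the value of `t` in the same fibre. Off the image of `e`
  -- nothing is replaced.
  let f : P → ι → P := fun q j => match l.idxFun j with
    | none => q
    | some t => if h : ∃ a, e a = π q then t.1 h.choose else q
  have hf_none : ∀ q j, l.idxFun j = none → f q j = q := fun q j h => by simp only [f, h]
  have hf_some : ∀ q j t a, l.idxFun j = some t → e a = π q → f q j = t.1 a := by
    intro q j t a h ha
    have hex : ∃ a, e a = π q := ⟨a, ha⟩
    simp only [f, h]
    rw [dif_pos hex, he (hex.choose_spec.trans ha.symm)]
  have hfL : ∀ q, f q iL = q := fun q => hf_none q iL hiL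
  have hfib : ∀ q j, π (f q j) = π q := by
    intro q j
    cases h : l.idxFun j with
    | none => rw [hf_none q j h]
    | some t =>
      by_cases hq : ∃ a, e a = π q
      · obtain ⟨a, ha⟩ := hq
        rw [hf_some q j t a h ha, t.2.proj, ha]
      · simp only [f, h]
        rw [dif_neg hq]
  -- Over `S` the distinguished coordinate is `i₀`, to agree with the coloured words; off `S` it is
  -- the active coordinate `iL`, where edges of `P` can be read back.
  let g : P → PartitePower π ι := fun q =>
    ⟨(f q, if π q ∈ S then i₀ else iL), fun j => by simp only [hfib]⟩
  have hproj : ∀ q, (g q).proj = π q := fun q => hfib _ _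
  refine ⟨g, ⟨hproj, fun p q hpq => ?_⟩, col, fun s hs => ?_⟩
  · unfold PartitePower.Edge
    rw [hproj, hproj]
    by_cases hS : π p ∈ S ∧ π q ∈ S
    · rw [if_pos hS]
      split_ifs with hGpq
      · intro j
        change E (f p j) (f q j)
        obtain ⟨a, b, ha, hb, hab⟩ := hGpq
        cases h : l.idxFun j with
        | none => rwa [hf_none p j h, hf_none q j h]
        | some t =>
          rw [hf_some p j t a h ha, hf_some q j t b h hb]
          exact t.2.map_edge _ _ hab
      -- An edge not following `G` needs only one coordinate as witness, and an active one carries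
      -- the original edge.
      · exact ⟨iL, by simpa only [g, hfL] using hpq⟩
    · rw [if_neg hS]
      by_cases hp : π p ∈ S <;> by_cases hq : π q ∈ S
      · exact absurd ⟨hp, hq⟩ hS
      all_goals simpa only [g, hp, hq, if_true, if_false, hfL] using hpq
  · rw [← hl ⟨s, hs⟩]
    congr 1
    ext1 a
    have ha : π (s a) ∈ S := ⟨a, (hs.proj a).symm⟩
    refine Subtype.ext (Prod.ext (funext fun j => ?_) (if_pos ha))
    change f (s a) j = (l ⟨s, hs⟩ j).1 a
    rw [Combinatorics.Line.coe_apply]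
    cases h : l.idxFun j with
    | none => exact hf_none _ _ h
    | some t => exact hf_some _ _ t a h (hs.proj a).symm

/-- The partite construction: the colour of a section can be made to depend on its projection
only. -/
theorem exists_partite_construction {X : Type u₁} {Y : Type u₂} (part : X → Y) {A : Type u}
    [Finite A] {EA : A → A → Prop} (hEA : ∀ a b, EA a b → ¬ EA b a) (κ : Type v) [Finite κ]
    [Nonempty κ] (l : List (A → X)) (hl : ∀ e ∈ l, Function.Injective e ∧
      ∀ a b, NonEdge EA a b → part (e a) = part (e b))
    {P : Type w} [Finite P] {π : P → X} {E : P → P → Prop} (hP : IsPartiteSystem part π E) :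
    ∃ (Q : Type w) (_ : Finite Q) (ρ : Q → X) (F : Q → Q → Prop), IsPartiteSystem part ρ F ∧
      ∀ c : (A → Q) → κ, ∃ g, IsHomOver π ρ E F g ∧
        ∀ e ∈ l, ∃ col, ∀ s, IsHomOver e π EA E s → c (g ∘ s) = col := by
  induction l generalizing P with
  | nil => exact ⟨P, ‹_›, π, E, hP, fun c => ⟨id, ⟨fun _ => rfl, fun _ _ h => h⟩, by simp⟩⟩
  | cons e l ih =>
    have he := hl e List.mem_cons_self
    obtain ⟨P₁, _, π₁, E₁, hP₁, h₁⟩ := exists_monochromatic_sections part hEA he.1 he.2 κ hP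
    obtain ⟨Q, hQ, ρ, F, hF, h₂⟩ := ih (fun e' h => hl e' (List.mem_cons_of_mem _ h)) hP₁
    refine ⟨Q, hQ, ρ, F, hF, fun c => ?_⟩
    obtain ⟨g₂, hg₂, hcol₂⟩ := h₂ c
    -- The colouring is pulled back along `g₂` before treating `e`. Since `g₁` carries sections to
    -- sections with the same projection, the homogeneity found for the tail survives.
    obtain ⟨g₁, hg₁, col₁, hcol₁⟩ := h₁ fun s => c (g₂ ∘ s)
    refine ⟨g₂ ∘ g₁, hg₂.comp hg₁, fun e' he' => ?_⟩
    rcases List.mem_cons.1 he' with rfl | he'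
    · exact ⟨col₁, hcol₁⟩
    · obtain ⟨col, hcol⟩ := hcol₂ e' he'
      exact ⟨col, fun s hs => hcol _ (hg₁.comp hs)⟩

/-! ### Convexly ordered digraphs and their embeddings. -/

/-- `(V, E)` is a complete multipartite directed graph and `lt` is a linear ordering of its vertices
for which each part is an interval. -/
structure IsConvexlyOrdered {V : Type u} (E lt : V → V → Prop) : Prop where
  multipartite : IsCompleteMultipartite E
  linear : IsStrictTotalOrder V lt
  convex : ∀ x y z, lt x y → lt y z → NonEdge E x z → NonEdge E x y

/-- `f` is an embedding of ordered directed graphs. -/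
structure IsOrderedEmbedding {A : Type u} {B : Type v} (EA ltA : A → A → Prop)
    (EB ltB : B → B → Prop) (f : A → B) : Prop where
  edge_iff : ∀ a b, EB (f a) (f b) ↔ EA a b
  lt_iff : ∀ a b, ltB (f a) (f b) ↔ ltA a b

section Basic

variable {A : Type u} {B : Type v} {C : Type w} {EA ltA : A → A → Prop} {EB ltB : B → B → Prop}
  {EC ltC : C → C → Prop}

theorem IsOrderedEmbedding.nonEdge_iff {f : A → B} (hf : IsOrderedEmbedding EA ltA EB ltB f)
    (a b : A) : NonEdge EB (f a) (f b) ↔ NonEdge EA a b := by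
  simp only [NonEdge, hf.edge_iff]

theorem IsOrderedEmbedding.comp {f : A → B} {g : B → C} (hg : IsOrderedEmbedding EB ltB EC ltC g)
    (hf : IsOrderedEmbedding EA ltA EB ltB f) : IsOrderedEmbedding EA ltA EC ltC (g ∘ f) where
  edge_iff a b := (hg.edge_iff _ _).trans (hf.edge_iff a b)
  lt_iff a b := (hg.lt_iff _ _).trans (hf.lt_iff a b)

theorem IsOrderedEmbedding.injective {f : A → B}
    (hf : IsOrderedEmbedding EA ltA EB ltB f) (hA : IsStrictTotalOrder A ltA)
    (hB : IsStrictTotalOrder B ltB) : Function.Injective f := by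
  intro a b hab
  by_contra hne
  rcases trichotomous_of ltA a b with h | h | h
  · have := (hf.lt_iff a b).2 h
    rw [hab] at this
    exact irrefl _ this
  · exact hne h
  · have := (hf.lt_iff b a).2 h
    rw [hab] at this
    exact irrefl _ this

theorem IsCompleteMultipartite.comap (hB : IsCompleteMultipartite EB) {f : A → B}
    (hf : ∀ a b, EB (f a) (f b) ↔ EA a b) : IsCompleteMultipartite EA := by
  have hN : ∀ a b, NonEdge EA a b ↔ NonEdge EB (f a) (f b) := fun a b => by
    simp only [NonEdge, hf]
  refine ⟨fun x y => ?_, fun x => ?_, fun {x y} => ?_, fun {x y z} => ?_⟩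
  · rw [← hf, ← hf]; exact hB.asymm _ _
  · rw [hN]; exact hB.equivalence.refl _
  · rw [hN, hN]; exact hB.equivalence.symm
  · rw [hN, hN, hN]; exact hB.equivalence.trans

theorem IsConvexlyOrdered.comap (hB : IsConvexlyOrdered EB ltB) {f : A → B}
    (hinj : Function.Injective f) (hf : IsOrderedEmbedding EA ltA EB ltB f) :
    IsConvexlyOrdered EA ltA := by
  have := hB.linear
  refine ⟨hB.multipartite.comap hf.edge_iff, { trichotomous := ?_, irrefl := ?_, trans := ?_ }, ?_⟩
  · intro a b h₁ h₂
    rw [← hf.lt_iff] at h₁ h₂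
    exact hinj (Std.Trichotomous.trichotomous _ _ h₁ h₂)
  · intro a
    rw [← hf.lt_iff]
    exact irrefl _
  · intro a b c
    rw [← hf.lt_iff, ← hf.lt_iff, ← hf.lt_iff]
    exact _root_.trans
  · intro x y z
    rw [← hf.lt_iff, ← hf.lt_iff, ← hf.nonEdge_iff, ← hf.nonEdge_iff]
    exact hB.convex _ _ _

/-- Vertices of different parts are ordered in the same way as their parts. -/
theorem IsConvexlyOrdered.lt_of_nonEdge (h : IsConvexlyOrdered EA ltA) {a b a' b' : A}
    (hab : ltA a b) (hne : ¬ NonEdge EA a b) (ha : NonEdge EA a a') (hb : NonEdge EA b b') :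
    ltA a' b' := by
  have := h.linear
  have hs := h.multipartite.equivalence
  have h₁ : ltA a' b := by
    rcases trichotomous_of ltA a' b with h₁ | rfl | h₁
    · exact h₁
    · exact absurd ha hne
    · exact absurd (h.convex _ _ _ hab h₁ ha) hne
  rcases trichotomous_of ltA a' b' with h₂ | rfl | h₂
  · exact h₂
  · exact absurd (hs.trans ha (hs.symm hb)) hne
  · exact absurd (hs.trans ha (hs.trans (hs.symm (h.convex _ _ _ h₂ h₁ (hs.symm hb)))
      (hs.symm hb))) hne

end Basic

/-! ### Skeletons and their images in a square. -/

section Parts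

variable {A : Type u} [LinearOrder A] {EA : A → A → Prop}

/-- The parts of a convexly ordered complete multipartite digraph. -/
def Parts (h : IsConvexlyOrdered EA (· < ·)) : Type u :=
  Quotient (⟨NonEdge EA, h.multipartite.equivalence⟩ : Setoid A)

namespace Parts

variable (h : IsConvexlyOrdered EA (· < ·))

/-- The part of a vertex. -/
def mk (a : A) : Parts h := Quotient.mk _ a

theorem mk_eq_mk {a b : A} : mk h a = mk h b ↔ NonEdge EA a b :=
  ⟨fun hab => Quotient.exact hab, fun hab => Quotient.sound hab⟩

noncomputable instance : LinearOrder (Parts h) :=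
  LinearOrder.lift' Quotient.out Quotient.out_injective

instance [Finite A] : Finite (Parts h) := inferInstanceAs (Finite (Quotient _))

/-- The order on `Parts h` compares arbitrarily chosen representatives; convexity makes the choice
irrelevant. -/
theorem mk_lt_mk_of_lt {a b : A} (hab : a < b) (hne : ¬ NonEdge EA a b) : mk h a < mk h b := by
  have hs := h.multipartite.equivalence
  have hout : ∀ a, NonEdge EA a (mk h a).out := fun a =>
    hs.symm ((mk_eq_mk h).1 (Quotient.out_eq _))
  exact h.lt_of_nonEdge hab hne (hout a) (hout b)

theorem mk_monotone : Monotone (mk h) := by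
  intro a b hab
  by_cases hne : NonEdge EA a b
  · exact ((mk_eq_mk h).2 hne).le
  · refine (mk_lt_mk_of_lt h (lt_of_le_of_ne hab ?_) hne).le
    rintro rfl
    exact hne (h.multipartite.equivalence.refl _)

end Parts

/-- The linear order which consists of the parts, followed by the vertices. -/
abbrev Skeleton (h : IsConvexlyOrdered EA (· < ·)) : Type u := Parts h ⊕ₗ A

instance [Finite A] (h : IsConvexlyOrdered EA (· < ·)) (N : ℕ) : Finite (Skeleton h ↪o Fin N) :=
  have : Finite (Skeleton h) := inferInstanceAs (Finite (_ ⊕ _))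
  DFunLike.finite _

/-- The map to the square of a linear order which is given by an embedding of the skeleton. -/
noncomputable def squareMap (h : IsConvexlyOrdered EA (· < ·)) {N : ℕ} (z : Skeleton h ↪o Fin N)
    (a : A) : Fin N × Fin N :=
  (z (Sum.inlₗ (Parts.mk h a)), z (Sum.inrₗ a))

theorem squareMap_injective (h : IsConvexlyOrdered EA (· < ·)) {N : ℕ}
    (z : Skeleton h ↪o Fin N) : Function.Injective (squareMap h z) := by
  intro a b hab
  simpa using z.injective (congrArg Prod.snd hab)

theorem squareMap_fst_eq_iff (h : IsConvexlyOrdered EA (· < ·)) {N : ℕ}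
    (z : Skeleton h ↪o Fin N) {a b : A} :
    (squareMap h z a).1 = (squareMap h z b).1 ↔ NonEdge EA a b := by
  simp [squareMap, Parts.mk_eq_mk]

/-- These inequalities are what makes the order of `IsPartiteSystem.exists_order` agree with the
given one on a copy lying over a square map. -/
theorem squareMap_lt (h : IsConvexlyOrdered EA (· < ·)) {N : ℕ}
    (z : Skeleton h ↪o Fin N) {a b : A} (hab : a < b) :
    (squareMap h z a).1 ≤ (squareMap h z b).1 ∧ (squareMap h z a).2 < (squareMap h z b).2 := by
  simp [squareMap, hab, Parts.mk_monotone h hab.le]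

variable {B : Type v} [LinearOrder B] {EB : B → B → Prop}

/-- The embedding of skeletons which is induced by an embedding. -/
theorem exists_skeleton_embedding (hA : IsConvexlyOrdered EA (· < ·))
    (hB : IsConvexlyOrdered EB (· < ·)) {f : A → B}
    (hf : IsOrderedEmbedding EA (· < ·) EB (· < ·) f) :
    ∃ u : Skeleton hA ↪o Skeleton hB, ∀ {N : ℕ} (w : Skeleton hB ↪o Fin N) a,
      squareMap hB w (f a) = squareMap hA (u.trans w) a := by
  let F : Parts hA → Parts hB := Quotient.lift (fun a => Parts.mk hB (f a)) fun a b hab =>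
    (Parts.mk_eq_mk hB).2 ((hf.nonEdge_iff a b).2 hab)
  have hF : StrictMono F := by
    intro p q hpq
    induction p using Quotient.inductionOn with | _ a
    induction q using Quotient.inductionOn with | _ b
    change Parts.mk hA a < Parts.mk hA b at hpq
    have hab : a < b := lt_of_not_ge fun hle => hpq.not_ge (Parts.mk_monotone hA hle)
    refine Parts.mk_lt_mk_of_lt hB ((hf.lt_iff a b).2 hab) fun hne => hpq.ne ?_
    exact (Parts.mk_eq_mk hA).2 ((hf.nonEdge_iff a b).1 hne)
  refine ⟨OrderEmbedding.ofStrictMono (fun x => toLex (Sum.map F f (ofLex x))) ?_, ?_⟩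
  · intro x y hxy
    rcases x with a | a <;> rcases y with b | b
    · exact Sum.Lex.inl_lt_inl_iff.2 (hF (Sum.Lex.inl_lt_inl_iff.1 hxy))
    · exact Sum.Lex.inl_lt_inr _ _
    · exact absurd hxy Sum.Lex.not_inr_lt_inl
    · exact Sum.Lex.inr_lt_inr_iff.2 ((hf.lt_iff a b).2 (Sum.Lex.inr_lt_inr_iff.1 hxy))
  · intro N w a
    rfl

/-- The initial system of the partite construction: the disjoint union of the copies of `B`. -/
theorem exists_initial_partiteSystem [Finite B] (hB : IsConvexlyOrdered EB (· < ·)) (N : ℕ) :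
    ∃ (P : Type v) (_ : Finite P) (π : P → Fin N × Fin N) (E : P → P → Prop),
      IsPartiteSystem Prod.fst π E ∧
        ∀ w : Skeleton hB ↪o Fin N, ∃ g, IsHomOver (squareMap hB w) π EB E g := by
  classical
  -- One copy of `B` for each embedding of its skeleton. Edges between distinct copies are arbitrary
  -- except that they must join exactly the points with different first coordinates, so they follow
  -- that coordinate.
  refine ⟨(Skeleton hB ↪o Fin N) × B, inferInstance, fun p => squareMap hB p.1 p.2,
    fun p q => if p.1 = q.1 then EB p.2 q.2 else
      (squareMap hB p.1 p.2).1 < (squareMap hB q.1 q.2).1, ⟨?_, ?_⟩,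
      fun w => ⟨fun b => (w, b), fun _ => rfl, fun a b hab => ?_⟩⟩
  · rintro ⟨w, a⟩ ⟨w', b⟩ h₁ h₂
    by_cases hw : w = w'
    · subst hw
      simp only [if_true] at h₁ h₂
      exact hB.multipartite.asymm _ _ h₁ h₂
    · simp only [hw, Ne.symm hw, if_false] at h₁ h₂
      exact lt_asymm h₁ h₂
  · rintro ⟨w, a⟩ ⟨w', b⟩
    by_cases hw : w = w'
    · subst hw
      simp only [squareMap_fst_eq_iff, NonEdge, if_true]
    · simp only [NonEdge, hw, Ne.symm hw, if_false, not_lt]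
      exact le_antisymm_iff.symm.trans eq_comm
  · simpa using hab

end Parts

/-! ### The Ramsey theorem for convexly ordered digraphs. -/

/-- A partite system over a square, ordered lexicographically, is convexly ordered. -/
theorem IsPartiteSystem.exists_order {N : ℕ} {P : Type w} [Finite P] {π : P → Fin N × Fin N}
    {E : P → P → Prop} (hP : IsPartiteSystem Prod.fst π E) :
    ∃ lt : P → P → Prop, IsConvexlyOrdered E lt ∧
      ∀ p q, (π p).1 ≤ (π q).1 → (π p).2 < (π q).2 → lt p q := by
  obtain ⟨n, ⟨t⟩⟩ := Finite.exists_equiv_fin P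
  -- The leading coordinate makes parts intervals; the enumeration `t` only breaks ties within a
  -- fibre.
  let key : P → Fin N ×ₗ (Fin N ×ₗ Fin n) := fun p => toLex ((π p).1, toLex ((π p).2, t p))
  have hkey : Function.Injective key := fun p q h =>
    t.injective (congrArg (fun x => (ofLex (ofLex x).2).2) h)
  have hfst : ∀ p q, key p < key q → (π p).1 ≤ (π q).1 := fun p q h =>
    (Prod.Lex.lt_iff.1 h).elim le_of_lt fun h => h.1.le
  refine ⟨fun p q => key p < key q, ⟨⟨hP.asymm, ?_⟩, ?_, ?_⟩, fun p q h₁ h₂ => ?_⟩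
  · exact ⟨fun p => (hP.nonEdge_iff p p).2 rfl,
      fun h => (hP.nonEdge_iff _ _).2 ((hP.nonEdge_iff _ _).1 h).symm,
      fun h h' => (hP.nonEdge_iff _ _).2
        (((hP.nonEdge_iff _ _).1 h).trans ((hP.nonEdge_iff _ _).1 h'))⟩
  · exact { trichotomous := fun p q h₁ h₂ => hkey (le_antisymm (not_lt.1 h₂) (not_lt.1 h₁))
            irrefl := fun p => lt_irrefl _
            trans := fun p q r => lt_trans }
  · intro x y z hxy hyz hxz
    rw [hP.nonEdge_iff] at hxz ⊢
    exact le_antisymm (hfst _ _ hxy) (hxz ▸ hfst _ _ hyz)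
  · rcases h₁.lt_or_eq with h₁ | h₁
    · exact Prod.Lex.lt_iff.2 (Or.inl h₁)
    · exact Prod.Lex.lt_iff.2 (Or.inr ⟨h₁, Prod.Lex.lt_iff.2 (Or.inl h₂)⟩)

/-- The Ramsey property of finite convexly ordered complete multipartite digraphs, in terms of
embeddings. -/
theorem ramsey_convexlyOrdered {A : Type u} {B : Type w} [Finite A] [Finite B]
    {EA ltA : A → A → Prop} {EB ltB : B → B → Prop} (hA : IsConvexlyOrdered EA ltA)
    (hB : IsConvexlyOrdered EB ltB) (κ : Type v) [Finite κ] [Nonempty κ] :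
    ∃ (C : Type w) (_ : Finite C) (EC ltC : C → C → Prop), IsConvexlyOrdered EC ltC ∧
      ∀ c : (A → C) → κ, ∃ j, IsOrderedEmbedding EB ltB EC ltC j ∧
        ∃ col, ∀ f, IsOrderedEmbedding EA ltA EB ltB f → c (j ∘ f) = col := by
  classical
  have := hA.linear
  have := hB.linear
  let : LinearOrder A := linearOrderOfSTO ltA
  let : LinearOrder B := linearOrderOfSTO ltB
  change IsConvexlyOrdered EA (· < ·) at hA
  change IsConvexlyOrdered EB (· < ·) at hB
  have : Finite (Skeleton hA) := inferInstanceAs (Finite (_ ⊕ _))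
  have : Finite (Skeleton hB) := inferInstanceAs (Finite (_ ⊕ _))
  obtain ⟨N, hN⟩ := ramsey_orderEmbedding (Skeleton hA) (Skeleton hB) κ
  obtain ⟨P, _, π, E, hP, hw⟩ := exists_initial_partiteSystem hB N
  have := Fintype.ofFinite (Skeleton hA ↪o Fin N)
  obtain ⟨C, hC, ρ, EC, hEC, hcol⟩ := exists_partite_construction Prod.fst hA.multipartite.asymm κ
    (Finset.univ.toList.map (squareMap hA (N := N)))
    (fun e he => by
      obtain ⟨z, -, rfl⟩ := List.mem_map.1 he
      exact ⟨squareMap_injective hA z, fun a b => (squareMap_fst_eq_iff hA z).2⟩) hP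
  obtain ⟨ltC, hCO, hlt⟩ := hEC.exists_order
  refine ⟨C, hC, EC, ltC, hCO, fun c => ?_⟩
  obtain ⟨g, hg, hgc⟩ := hcol c
  -- `χ z` is the common colour of the sections over the image given by `z`, so it colours skeleton
  -- embeddings.
  choose χ hχ using fun z => hgc (squareMap hA z) (List.mem_map_of_mem (by simp))
  obtain ⟨w, col, hwc⟩ := hN χ
  obtain ⟨g₀, hg₀⟩ := hw w
  have hj := hg.comp hg₀
  have hmono : ∀ a b, a < b → ltC ((g ∘ g₀) a) ((g ∘ g₀) b) := by
    intro a b hab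
    have := squareMap_lt hB w hab
    rw [← hj.proj, ← hj.proj] at this
    exact hlt _ _ this.1 this.2
  have := hCO.linear
  refine ⟨g ∘ g₀, ⟨fun a b => ⟨fun hab => ?_, hj.map_edge a b⟩,
    fun a b => ⟨fun hab => ?_, hmono a b⟩⟩, col, fun f hf => ?_⟩
  -- Preserving edges suffices for reflecting them: if the edge is absent in `B`, either the
  -- opposite edge is preserved or both ends lie in one part.
  · by_contra hn
    by_cases hba : EB b a
    · exact hEC.asymm _ _ hab (hj.map_edge b a hba)
    · refine hEC.not_edge ?_ hab
      rw [hj.proj, hj.proj]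
      exact (squareMap_fst_eq_iff hB w).2 ⟨hn, hba⟩
  · rcases lt_trichotomy a b with h | rfl | h
    · exact h
    · exact absurd hab (irrefl _)
    · exact absurd hab (asymm_of ltC (hmono b a h))
  · obtain ⟨u, hu⟩ := exists_skeleton_embedding hA hB hf
    rw [← hwc u, Function.comp_assoc]
    refine hχ _ _ ⟨fun a => ?_, fun a b hab => hg₀.map_edge _ _ ((hf.edge_iff a b).2 hab)⟩
    rw [← hu w a]
    exact hg₀.proj _

/-! ### The ordering property. -/

section Ordering

variable {A : Type u} {B : Type v} {EA ltA : A → A → Prop} {EB ltB : B → B → Prop}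

theorem IsCompleteMultipartite.sumLex (hA : IsCompleteMultipartite EA)
    (hB : IsCompleteMultipartite EB) : IsCompleteMultipartite (Sum.Lex EA EB) := by
  refine ⟨?_, ⟨?_, ?_, ?_⟩⟩
  · rintro (a | a) (b | b) <;> simp
    exacts [hA.asymm a b, hB.asymm a b]
  · rintro (a | a) <;> simp only [NonEdge, Sum.lex_inl_inl, Sum.lex_inr_inr]
    exacts [hA.equivalence.refl a, hB.equivalence.refl a]
  · exact And.symm
  · rintro (a | a) (b | b) (c | c) <;> simp [NonEdge]
    exacts [fun h₁ h₂ h₃ h₄ => hA.equivalence.trans ⟨h₁, h₂⟩ ⟨h₃, h₄⟩,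
      fun h₁ h₂ h₃ h₄ => hB.equivalence.trans ⟨h₁, h₂⟩ ⟨h₃, h₄⟩]

/-- The ordered sum of two convexly ordered complete multipartite digraphs. -/
theorem IsConvexlyOrdered.sumLex (hA : IsConvexlyOrdered EA ltA) (hB : IsConvexlyOrdered EB ltB) :
    IsConvexlyOrdered (Sum.Lex EA EB) (Sum.Lex ltA ltB) := by
  have := hA.linear
  have := hB.linear
  refine ⟨hA.multipartite.sumLex hB.multipartite, {}, ?_⟩
  rintro (a | a) (b | b) (c | c) <;> simp [NonEdge]
  exacts [fun h₁ h₂ h₃ h₄ => hA.convex a b c h₁ h₂ ⟨h₃, h₄⟩,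
    fun h₁ h₂ h₃ h₄ => hB.convex a b c h₁ h₂ ⟨h₃, h₄⟩]

theorem isOrderedEmbedding_inl :
    IsOrderedEmbedding EA ltA (Sum.Lex EA EB) (Sum.Lex ltA ltB) Sum.inl :=
  ⟨fun _ _ => Sum.lex_inl_inl, fun _ _ => Sum.lex_inl_inl⟩

theorem isOrderedEmbedding_inr :
    IsOrderedEmbedding EB ltB (Sum.Lex EA EB) (Sum.Lex ltA ltB) Sum.inr :=
  ⟨fun _ _ => Sum.lex_inr_inr, fun _ _ => Sum.lex_inr_inr⟩

/-- Any ordering can be made to depend only on the convex ordering for pairs of a given type. -/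
theorem exists_pair_homogeneous [Finite B] (hB : IsConvexlyOrdered EB ltB) (p q : Prop)
    (hpq : ¬ (p ∧ q)) :
    ∃ (C : Type v) (_ : Finite C) (EC ltC : C → C → Prop), IsConvexlyOrdered EC ltC ∧
      ∀ lt : C → C → Prop, ∃ j, IsOrderedEmbedding EB ltB EC ltC j ∧
        ∃ r : Prop, ∀ x y, ltB x y → (EB x y ↔ p) → (EB y x ↔ q) → (lt (j x) (j y) ↔ r) := by
  -- A two-vertex pattern, coloured below by the truth value of `lt` on its image, with `Prop` as
  -- the set of colours.
  let E₂ : Bool → Bool → Prop := fun a b => a < b ∧ p ∨ b < a ∧ q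
  have h₂ : IsConvexlyOrdered E₂ (· < ·) := by
    refine ⟨⟨?_, ⟨?_, ?_, ?_⟩⟩, inferInstance, ?_⟩ <;>
      simp only [NonEdge, E₂, Bool.forall_bool] <;> simp <;> tauto
  obtain ⟨C, hC, EC, ltC, hCO, hc⟩ := ramsey_convexlyOrdered h₂ hB Prop
  refine ⟨C, hC, EC, ltC, hCO, fun lt => ?_⟩
  obtain ⟨j, hj, r, hr⟩ := hc fun f => lt (f false) (f true)
  have := hB.linear
  refine ⟨j, hj, r, fun x y hxy hp hq => ?_⟩
  have h := hr (fun i => cond i y x) ⟨?_, ?_⟩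
  · exact iff_of_eq h
  · have hirr : ∀ a, ¬ EB a a := fun a h => hB.multipartite.asymm a a h h
    simp [E₂, hirr, hp, hq]
  · simp [hxy, irrefl, asymm_of ltB hxy]

/-- The ordering obtained from a convex ordering by reversing it inside the parts unless `p`, and
between the parts unless `q`. -/
def reorder (E lt : A → A → Prop) (p q : Prop) (x y : A) : Prop :=
  (NonEdge E x y ∧ (p ∧ lt x y ∨ ¬ p ∧ lt y x)) ∨ (¬ NonEdge E x y ∧ (q ∧ lt x y ∨ ¬ q ∧ lt y x))

/-- By convexity the order between two parts does not depend on the vertices (`hpart`), so reversing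
it independently of the order inside parts keeps transitivity and convexity. -/
theorem IsConvexlyOrdered.reorder (hA : IsConvexlyOrdered EA ltA) (p q : Prop) :
    IsConvexlyOrdered EA (reorder EA ltA p q) := by
  have := hA.linear
  have hs := hA.multipartite.equivalence
  have hpart : ∀ {x y x' y'}, ¬ NonEdge EA x y → NonEdge EA x x' → NonEdge EA y y' →
      PartiteDigraph.reorder EA ltA p q x y → PartiteDigraph.reorder EA ltA p q x' y' := by
    intro x y x' y' hxy hx hy h
    have hxy' : ¬ NonEdge EA x' y' := fun h' => hxy (hs.trans hx (hs.trans h' (hs.symm hy)))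
    obtain h | h := (h.resolve_left fun h => hxy h.1).2
    · exact Or.inr ⟨hxy', Or.inl ⟨h.1, hA.lt_of_nonEdge h.2 hxy hx hy⟩⟩
    · exact Or.inr ⟨hxy', Or.inr ⟨h.1, hA.lt_of_nonEdge h.2 (fun h => hxy (hs.symm h)) hy hx⟩⟩
  have htrans : ∀ x y z, PartiteDigraph.reorder EA ltA p q x y →
      PartiteDigraph.reorder EA ltA p q y z → PartiteDigraph.reorder EA ltA p q x z := by
    intro x y z hxy hyz
    by_cases h₁ : NonEdge EA x y
    · by_cases h₂ : NonEdge EA y z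
      · have hxy := (hxy.resolve_right fun h => h.1 h₁).2
        have hyz := (hyz.resolve_right fun h => h.1 h₂).2
        refine Or.inl ⟨hs.trans h₁ h₂, ?_⟩
        rcases hxy with ⟨hp, hxy⟩ | ⟨hp, hxy⟩
        · exact Or.inl ⟨hp, _root_.trans hxy (hyz.resolve_right fun h => h.1 hp).2⟩
        · exact Or.inr ⟨hp, _root_.trans (hyz.resolve_left fun h => hp h.1).2 hxy⟩
      · exact hpart h₂ (hs.symm h₁) (hs.refl _) hyz
    · by_cases h₂ : NonEdge EA y z
      · exact hpart h₁ (hs.refl _) h₂ hxy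
      · have hxy := (hxy.resolve_left fun h => h₁ h.1).2
        have hyz := (hyz.resolve_left fun h => h₂ h.1).2
        rcases hxy with ⟨hq, hxy⟩ | ⟨hq, hxy⟩
        · have hyz := (hyz.resolve_right fun h => h.1 hq).2
          exact Or.inr ⟨fun h => h₁ (hA.convex _ _ _ hxy hyz h),
            Or.inl ⟨hq, _root_.trans hxy hyz⟩⟩
        · have hyz := (hyz.resolve_left fun h => hq h.1).2
          exact Or.inr ⟨fun h => h₂ (hs.symm (hA.convex _ _ _ hyz hxy (hs.symm h))),
            Or.inr ⟨hq, _root_.trans hyz hxy⟩⟩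
  have hirr : ∀ x, ¬ PartiteDigraph.reorder EA ltA p q x x := fun x h => by
    simp [PartiteDigraph.reorder, irrefl] at h
  refine ⟨hA.multipartite, { trichotomous := ?_, irrefl := hirr, trans := htrans }, ?_⟩
  · intro x y h₁ h₂
    have hsymm : NonEdge EA y x ↔ NonEdge EA x y := ⟨hs.symm, hs.symm⟩
    rcases trichotomous_of ltA x y with h | h | h
    · simp only [PartiteDigraph.reorder, hsymm, h, asymm_of ltA h] at h₁ h₂
      tauto
    · exact h
    · simp only [PartiteDigraph.reorder, hsymm, h, asymm_of ltA h] at h₁ h₂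
      tauto
  · intro x y z hxy hyz hxz
    by_contra hne
    exact hirr _ (htrans _ _ _ hyz (hpart hne (hs.refl _) (hs.refl _) hxy |> hpart hne hxz (hs.refl _)))

/-- The directed cycle of length three. -/
theorem isConvexlyOrdered_cycle :
    IsConvexlyOrdered (fun i j : Fin 3 => j = i + 1) (· < ·) := by
  refine ⟨⟨by decide, ⟨?_, ?_, ?_⟩⟩, inferInstance, ?_⟩ <;> unfold NonEdge <;> decide

/-- The ordering property: a finite convexly ordered complete multipartite digraph embeds in every
linear ordering of a suitable finite complete multipartite digraph. -/
theorem exists_ordering_property [Finite A] (hA : IsConvexlyOrdered EA ltA) :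
    ∃ (C : Type u) (_ : Finite C) (EC : C → C → Prop), IsCompleteMultipartite EC ∧
      ∀ lt, IsStrictTotalOrder C lt → ∃ j, IsOrderedEmbedding EA ltA EC lt j := by
  -- `B` holds all four reorderings of `A`, one to match each possible behaviour of `lt`, and a
  -- directed triangle tying forward to backward edges.
  obtain ⟨B, _, EB, ltB, hB, hcyc, hre⟩ : ∃ (B : Type u) (_ : Finite B) (EB ltB : B → B → Prop),
      IsConvexlyOrdered EB ltB ∧
      (∃ f, IsOrderedEmbedding (fun i j : Fin 3 => j = i + 1) (· < ·) EB ltB f) ∧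
      ∀ p q, ∃ f, IsOrderedEmbedding EA (reorder EA ltA p q) EB ltB f := by
    have h := ((((hA.reorder True True).sumLex (hA.reorder True False)).sumLex
      ((hA.reorder False True).sumLex (hA.reorder False False))).sumLex isConvexlyOrdered_cycle)
    refine ⟨_, inferInstance, _, _, h, ⟨_, isOrderedEmbedding_inr⟩, fun p q => ?_⟩
    by_cases hp : p <;> by_cases hq : q <;> simp only [hp, hq]
    · exact ⟨_, isOrderedEmbedding_inl.comp (isOrderedEmbedding_inl.comp isOrderedEmbedding_inl)⟩
    · exact ⟨_, isOrderedEmbedding_inl.comp (isOrderedEmbedding_inl.comp isOrderedEmbedding_inr)⟩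
    · exact ⟨_, isOrderedEmbedding_inl.comp (isOrderedEmbedding_inr.comp isOrderedEmbedding_inl)⟩
    · exact ⟨_, isOrderedEmbedding_inl.comp (isOrderedEmbedding_inr.comp isOrderedEmbedding_inr)⟩
  -- Relative to the convex order a pair is a non-edge, a forward edge or a backward edge. Each type
  -- is homogenised in turn.
  obtain ⟨C₁, _, E₁, lt₁, hC₁, h₁⟩ := exists_pair_homogeneous hB False False (by simp)
  obtain ⟨C₂, _, E₂, lt₂, hC₂, h₂⟩ := exists_pair_homogeneous hC₁ True False (by simp)
  obtain ⟨C₃, hfin, E₃, lt₃, hC₃, h₃⟩ := exists_pair_homogeneous hC₂ False True (by simp)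
  refine ⟨C₃, hfin, E₃, hC₃.multipartite, fun lt hlt => ?_⟩
  obtain ⟨j₃, hj₃, r₃, hr₃⟩ := h₃ lt
  obtain ⟨j₂, hj₂, r₂, hr₂⟩ := h₂ fun x y => lt (j₃ x) (j₃ y)
  obtain ⟨j₁, hj₁, r₁, hr₁⟩ := h₁ fun x y => lt (j₃ (j₂ x)) (j₃ (j₂ y))
  have hj := hj₃.comp (hj₂.comp hj₁)
  set j := j₃ ∘ j₂ ∘ j₁
  have hnon : ∀ x y, ltB x y → NonEdge EB x y → (lt (j x) (j y) ↔ r₁) := fun x y hxy h =>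
    hr₁ x y hxy (iff_false_intro h.1) (iff_false_intro h.2)
  have hfwd : ∀ x y, ltB x y → EB x y → (lt (j x) (j y) ↔ r₂) := fun x y hxy h =>
    hr₂ _ _ ((hj₁.lt_iff x y).2 hxy) (iff_true_intro ((hj₁.edge_iff x y).2 h))
      (iff_false_intro fun h' => hB.multipartite.asymm x y h ((hj₁.edge_iff y x).1 h'))
  have hbwd : ∀ x y, ltB x y → EB y x → (lt (j x) (j y) ↔ r₃) := fun x y hxy h =>
    hr₃ _ _ (((hj₂.comp hj₁).lt_iff x y).2 hxy)
      (iff_false_intro fun h' =>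
        hB.multipartite.asymm x y (((hj₂.comp hj₁).edge_iff x y).1 h') h)
      (iff_true_intro (((hj₂.comp hj₁).edge_iff y x).2 h))
  have hneg : ∀ {x y}, ltB x y → (¬ lt (j x) (j y) ↔ lt (j y) (j x)) := by
    intro x y hxy
    refine ⟨fun h => ?_, fun h => asymm_of lt h⟩
    rcases trichotomous_of lt (j x) (j y) with h' | h' | h'
    · exact absurd h' h
    · have hxy' := (hj.lt_iff x y).2 hxy
      rw [h'] at hxy'
      exact absurd hxy' (hC₃.linear.irrefl _)
    · exact h'
  -- In the triangle the pairs 01 and 12 are forward and 02 is backward, so transitivity of `lt`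
  -- forces the two types to behave alike.
  have hr : r₂ ↔ r₃ := by
    obtain ⟨f, hf⟩ := hcyc
    have h01 := (hf.lt_iff 0 1).2 (by decide)
    have h12 := (hf.lt_iff 1 2).2 (by decide)
    have h02 := (hf.lt_iff 0 2).2 (by decide)
    have e01 := hfwd _ _ h01 ((hf.edge_iff 0 1).2 (by decide))
    have e12 := hfwd _ _ h12 ((hf.edge_iff 1 2).2 (by decide))
    have e02 := hbwd _ _ h02 ((hf.edge_iff 2 0).2 (by decide))
    constructor
    · intro h
      exact e02.1 (_root_.trans (e01.2 h) (e12.2 h))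
    · intro h
      by_contra hn
      have h21 := (hneg h12).1 fun h' => hn (e12.1 h')
      have h10 := (hneg h01).1 fun h' => hn (e01.1 h')
      exact asymm_of lt (e02.2 h) (_root_.trans h21 h10)
  have hcross : ∀ x y, ltB x y → ¬ NonEdge EB x y → (lt (j x) (j y) ↔ r₂) := by
    intro x y hxy h
    by_cases hE : EB x y
    · exact hfwd x y hxy hE
    · exact (hbwd x y hxy (by_contra fun h' => h ⟨hE, h'⟩)).trans hr.symm
  -- On the copy of `B`, `lt` is the reordering with parameters `r₁`, `r₂`. Reordering is an
  -- involution, so on the copy of `A` already reordered this way `lt` gives back `ltA`.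
  obtain ⟨f, hf⟩ := hre r₁ r₂
  have hmono : ∀ a b, ltA a b → lt ((j ∘ f) a) ((j ∘ f) b) := by
    intro a b hab
    have hs := hA.multipartite.equivalence
    by_cases hN : NonEdge EA a b
    · by_cases hr₁ : r₁
      · refine (hnon _ _ ((hf.lt_iff a b).2 ?_) ((hf.nonEdge_iff a b).2 hN)).2 hr₁
        exact Or.inl ⟨hN, Or.inl ⟨hr₁, hab⟩⟩
      · have h : ltB (f b) (f a) := (hf.lt_iff b a).2 (Or.inl ⟨hs.symm hN, Or.inr ⟨hr₁, hab⟩⟩)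
        exact (hneg h).1 fun h' => hr₁ ((hnon _ _ h ((hf.nonEdge_iff b a).2 (hs.symm hN))).1 h')
    · have hN' : ¬ NonEdge EA b a := fun h => hN (hs.symm h)
      by_cases hr₂ : r₂
      · refine (hcross _ _ ((hf.lt_iff a b).2 ?_) (mt (hf.nonEdge_iff a b).1 hN)).2 hr₂
        exact Or.inr ⟨hN, Or.inl ⟨hr₂, hab⟩⟩
      · have h : ltB (f b) (f a) := (hf.lt_iff b a).2 (Or.inr ⟨hN', Or.inr ⟨hr₂, hab⟩⟩)
        exact (hneg h).1 fun h' => hr₂ ((hcross _ _ h (mt (hf.nonEdge_iff b a).1 hN')).1 h')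
  have := hA.linear
  refine ⟨j ∘ f, fun a b => (hj.edge_iff _ _).trans (hf.edge_iff a b),
    fun a b => ⟨fun h => ?_, hmono a b⟩⟩
  rcases trichotomous_of ltA a b with h' | rfl | h'
  · exact h'
  · exact absurd h (irrefl _)
  · exact absurd h (asymm_of lt (hmono b a h'))

end Ordering

/-! ### Translation to first-order structures, and the age. -/

open FirstOrder FirstOrder.Language CategoryTheory

/-- The edge relation of a structure in the language of ordered directed graphs. -/
def OrderedEdge (A : Type u) [orderedDigraphLang.Structure A] (x y : A) : Prop :=
  Structure.RelMap (L := orderedDigraphLang) (M := A) OrderedDigraphRel.edge ![x, y]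

/-- The ordering of a structure in the language of ordered directed graphs. -/
def OrderedLt (A : Type u) [orderedDigraphLang.Structure A] (x y : A) : Prop :=
  Structure.RelMap (L := orderedDigraphLang) (M := A) OrderedDigraphRel.lt ![x, y]

section Embeddings

variable {A : Type u} {B : Type v} [orderedDigraphLang.Structure A] [orderedDigraphLang.Structure B]

theorem relMap_edge (x : Fin 2 → A) :
    Structure.RelMap (L := orderedDigraphLang) OrderedDigraphRel.edge x ↔
      OrderedEdge A (x 0) (x 1) := by
  unfold OrderedEdge
  rw [show x = ![x 0, x 1] from funext fun i => by fin_cases i <;> rfl]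
  rfl

theorem relMap_lt (x : Fin 2 → A) :
    Structure.RelMap (L := orderedDigraphLang) OrderedDigraphRel.lt x ↔
      OrderedLt A (x 0) (x 1) := by
  unfold OrderedLt
  rw [show x = ![x 0, x 1] from funext fun i => by fin_cases i <;> rfl]
  rfl

/-- An injective embedding of ordered directed graphs as an embedding of structures. -/
def IsOrderedEmbedding.toEmbedding {f : A → B}
    (hf : IsOrderedEmbedding (OrderedEdge A) (OrderedLt A) (OrderedEdge B) (OrderedLt B) f)
    (hinj : Function.Injective f) : A ↪[orderedDigraphLang] B where
  toFun := f
  inj' := hinj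
  map_fun' g := g.elim
  map_rel' R x := by
    cases R with
    | edge => exact (relMap_edge _).trans ((hf.edge_iff _ _).trans (relMap_edge x).symm)
    | lt => exact (relMap_lt _).trans ((hf.lt_iff _ _).trans (relMap_lt x).symm)

theorem isOrderedEmbedding_of_embedding (f : A ↪[orderedDigraphLang] B) :
    IsOrderedEmbedding (OrderedEdge A) (OrderedLt A) (OrderedEdge B) (OrderedLt B) f where
  edge_iff a b := (relMap_edge (f ∘ ![a, b])).symm.trans (f.map_rel OrderedDigraphRel.edge _)
  lt_iff a b := (relMap_lt (f ∘ ![a, b])).symm.trans (f.map_rel OrderedDigraphRel.lt _)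

/-- A partition relation for embeddings implies the one for copies. -/
theorem arrows_of_embeddings {L : FirstOrder.Language} {A B C : Type w} [L.Structure A]
    [L.Structure B] [L.Structure C] {k : ℕ}
    (h : ∀ c : (A → C) → Option (Fin k), ∃ j : B ↪[L] C, ∃ col, ∀ f : A ↪[L] B,
      c (j ∘ f) = col) :
    Arrows (L := L) C B A k 1 := by
  classical
  intro c
  -- A map is coloured through its range; `none` serves maps whose range is not a copy of `A`.
  obtain ⟨j, col, hj⟩ := h fun f =>
    if hf : ∃ S : Copies (L := L) C A, (S.1 : Set C) = Set.range f then some (c hf.choose) else none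
  have hcol : ∀ S : Copies (L := L) C A, S.1 ≤ j.toHom.range → some (c S) = col := by
    rintro ⟨S, ⟨φ⟩⟩ hS
    let f : A ↪[L] B := j.equivRange.symm.toEmbedding.comp
      ((Substructure.inclusion hS).comp φ.symm.toEmbedding)
    have hjf : ∀ a, j (f a) = (φ.symm a : C) := fun a =>
      congrArg Subtype.val (j.equivRange.apply_symm_apply (Substructure.inclusion hS (φ.symm a)))
    have hrange : (S : Set C) = Set.range (j ∘ f) := by
      ext x
      refine ⟨fun hx => ⟨φ ⟨x, hx⟩, ?_⟩, ?_⟩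
      · rw [Function.comp_apply, hjf, φ.symm_apply_apply]
      · rintro ⟨a, rfl⟩
        rw [Function.comp_apply, hjf]
        exact (φ.symm a).2
    have hex : ∃ S' : Copies (L := L) C A, (S'.1 : Set C) = Set.range (j ∘ f) :=
      ⟨⟨S, ⟨φ⟩⟩, hrange⟩
    have := hj f
    rw [dif_pos hex] at this
    rw [← this]
    congr 2
    exact Subtype.ext (SetLike.coe_injective (hrange.trans hex.choose_spec.symm))
  refine ⟨j.toHom.range, ⟨j.equivRange.symm⟩, (Set.ncard_le_one_iff (Set.toFinite _)).2 ?_⟩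
  rintro _ _ ⟨S, hS, rfl⟩ ⟨S', hS', rfl⟩
  exact Option.some_injective _ ((hcol S hS).trans (hcol S' hS').symm)

end Embeddings

section Age

variable {V : Type u} {E lt : V → V → Prop}

/-- A finite digraph is an induced subgraph of the generic multipartite digraph if and only if it is
complete multipartite. -/
theorem IsGenericMultipartite.exists_embedding_iff [Countable V] (hE : IsGenericMultipartite E)
    {A : Type u} [Finite A] (EA : A → A → Prop) :
    (∃ f : A → V, Function.Injective f ∧ ∀ a b, E (f a) (f b) ↔ EA a b) ↔
      IsCompleteMultipartite EA := by
  let := digraphStructure E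
  let := digraphStructure EA
  have hage := Set.ext_iff.1 hE.age ⟨A, inferInstance⟩
  have hmem : (⟨A, inferInstance⟩ : Bundled digraphLang.Structure) ∈ finiteCompleteMultipartite ↔
      IsCompleteMultipartite EA := ⟨fun h => h.2, fun h => ⟨inferInstance, h⟩⟩
  rw [← hmem, ← hage]
  constructor
  · rintro ⟨f, hinj, hf⟩
    refine ⟨Structure.FG.of_finite, ⟨⟨⟨f, hinj⟩, fun g => g.elim, fun R x => ?_⟩⟩⟩
    cases R
    exact hf _ _
  · rintro ⟨-, ⟨f⟩⟩
    exact ⟨f, f.injective, fun a b => f.map_rel DigraphRel.edge ![a, b]⟩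

/-- The axioms involve at most three vertices, so they pass from finite induced subgraphs to `V`. -/
theorem IsGenericMultipartite.isCompleteMultipartite [Countable V] (hE : IsGenericMultipartite E) :
    IsCompleteMultipartite E := by
  have hsub : ∀ s : Set V, s.Finite → IsCompleteMultipartite fun a b : s => E a b := fun s hs =>
    have := hs.to_subtype
    (hE.exists_embedding_iff _).1 ⟨Subtype.val, Subtype.val_injective, fun _ _ => Iff.rfl⟩
  have hasymm : ∀ x y, E x y → ¬ E y x := fun x y =>
    (hsub {x, y} (by simp)).asymm ⟨x, by simp⟩ ⟨y, by simp⟩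
  refine ⟨hasymm, fun x => ⟨fun h => hasymm x x h h, fun h => hasymm x x h h⟩, And.symm, ?_⟩
  intro x y z hxy hyz
  exact (hsub {x, y, z} (by simp)).equivalence.trans (x := ⟨x, by simp⟩) (y := ⟨y, by simp⟩)
    (z := ⟨z, by simp⟩) hxy hyz

theorem mem_orderedAge_iff {A : Bundled.{u} orderedDigraphLang.Structure} :
    A ∈ orderedAge E lt ↔ Finite A ∧ ∃ f : A → V, Function.Injective f ∧
      IsOrderedEmbedding (OrderedEdge A) (OrderedLt A) E lt f := by
  let := orderedDigraphStructure E lt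
  constructor
  · rintro ⟨hfg, ⟨f⟩⟩
    exact ⟨hfg.finite, f, f.injective, isOrderedEmbedding_of_embedding f⟩
  · rintro ⟨_, f, hinj, hf⟩
    exact ⟨Structure.FG.of_finite,
      ⟨IsOrderedEmbedding.toEmbedding (B := V) ⟨hf.edge_iff, hf.lt_iff⟩ hinj⟩⟩

/-- The age of the ordered generic multipartite digraph consists of all finite convexly ordered
complete multipartite digraphs. -/
theorem mem_orderedAge_iff_isConvexlyOrdered [Countable V] (hE : IsGenericMultipartite E)
    (hlt : IsDenseConvexOrder E lt) {A : Bundled.{u} orderedDigraphLang.Structure} :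
    A ∈ orderedAge E lt ↔ Finite A ∧ IsConvexlyOrdered (OrderedEdge A) (OrderedLt A) := by
  rw [mem_orderedAge_iff]
  refine and_congr_right fun hfin => ⟨?_, fun hA => ?_⟩
  · rintro ⟨f, hinj, hf⟩
    exact IsConvexlyOrdered.comap ⟨hE.isCompleteMultipartite, hlt.linear, hlt.convex⟩ hinj hf
  -- Genericity embeds the unordered `C` in `V`; whatever ordering `C` inherits there, it contains
  -- `A`.
  · obtain ⟨C, _, EC, hC, hord⟩ := exists_ordering_property hA
    obtain ⟨i, hi, hiE⟩ := (hE.exists_embedding_iff EC).2 hC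
    have := hlt.linear
    have hCV : IsOrderedEmbedding EC (fun a b => lt (i a) (i b)) E lt i := ⟨hiE, fun _ _ => Iff.rfl⟩
    obtain ⟨j, hj⟩ := hord (fun a b => lt (i a) (i b))
      { trichotomous := fun a b h₁ h₂ => hi (Std.Trichotomous.trichotomous _ _ h₁ h₂)
        irrefl := fun a => irrefl _
        trans := fun a b c => _root_.trans }
    have hij := hCV.comp hj
    exact ⟨i ∘ j, hij.injective hA.linear hlt.linear, hij⟩

end Age

end PartiteDigraph

theorem mainTheorem6 {V : Type*} [Countable V] (E lt : V → V → Prop)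
    (hE : PartiteDigraph.IsGenericMultipartite E)
    (hlt : PartiteDigraph.IsDenseConvexOrder E lt) :
    PartiteDigraph.RamseyProperty (PartiteDigraph.orderedAge E lt) := by
  intro k A hA B hB
  rw [PartiteDigraph.mem_orderedAge_iff_isConvexlyOrdered hE hlt] at hA hB
  obtain ⟨_, hA⟩ := hA
  obtain ⟨_, hB⟩ := hB
  obtain ⟨C, hC, EC, ltC, hCO, hc⟩ :=
    -- `Option` also keeps the set of colours nonempty when `k = 0`.
    PartiteDigraph.ramsey_convexlyOrdered hA hB (Option (Fin k))
  let := PartiteDigraph.orderedDigraphStructure EC ltC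
  refine ⟨⟨C, inferInstance⟩,
    (PartiteDigraph.mem_orderedAge_iff_isConvexlyOrdered hE hlt).2 ⟨hC, hCO⟩,
    PartiteDigraph.arrows_of_embeddings fun c => ?_⟩
  obtain ⟨j, hj, col, hcol⟩ := hc c
  have hj' : PartiteDigraph.IsOrderedEmbedding (PartiteDigraph.OrderedEdge B)
      (PartiteDigraph.OrderedLt B) (PartiteDigraph.OrderedEdge C) (PartiteDigraph.OrderedLt C) j :=
    ⟨hj.edge_iff, hj.lt_iff⟩
  exact ⟨hj'.toEmbedding (hj'.injective hB.linear hCO.linear), col, fun f =>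
    hcol f (PartiteDigraph.isOrderedEmbedding_of_embedding f)⟩
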